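/- For a finite undirected graph $G=(V,E)$ (loops and multiple edges allowed) and complex numbers $q,v$, let $$Z_G(q,v)\;=\;\sum_{E'\subseteq E} q^{k(E')}\,v^{|E'|},$$ where $k(E')$ is the number of connected components (including isolated vertices) of the subgraph $(V,E')$; this is the dichromatic polynomial (Potts-model partition function with all edge weights equal to $v$). For integers $s,p\ge 1$ let $\Theta^{(s,p)}$ be the generalized theta graph, consisting of two endvertices joined by $p$ internally disjoint paths of $s$ edges each. (a) Fix a complex number $v_0\neq 0$. Then, for each $\epsilon>0$ and $R<\infty$, there exist $s_0\in\mathbb N$ and a map $p_0\colon \mathbb N\cap[s_0,\infty)\to\mathbb N$ such that for all $s\ge s_0$ and $p\ge p_0(s)$, the zeros of $Z_{\Theta^{(s,p)}}(\,\cdot\,,v_0)$ come within $\epsilon$ of every point of the region $\{q\in\mathbb C:\ |q+v_0|\ge |v_0| \text{ and } |q|\le R\}$; that is, for every $q$ in this region there is $q'\in\mathbb C$ with $Z_{\Theta^{(s,p)}}(q',v_0)=0$ and $|q'-q|<\epsilon$. (b) Fix a complex number $q_0\neq 1$. Then, for each $\epsilon>0$ and $R<\infty$, there exist $s_0\in\mathbb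 N$ and a map $p_0\colon \mathbb N\cap[s_0,\infty)\to\mathbb N$ such that for all $s\ge s_0$ and $p\ge p_0(s)$, the zeros of $Z_{\Theta^{(s,p)}}(q_0,\,\cdot\,)$ come within $\epsilon$ of every point of the region $\{v\in\mathbb C:\ |v|\le |q_0+v| \text{ and } |v|\le R\}$; that is, for every $v$ in this region there is $v'\in\mathbb C$ with $Z_{\Theta^{(s,p)}}(q_0,v')=0$ and $|v'-v|<\epsilon$. -/

import Mathlib

/-- `k(F)`: the number of connected components (including isolated vertices) of the spanning
subgraph `(V, F)` of the multigraph `G`. -/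
noncomputable def numComponents {α β : Type*} (G : Graph α β) (F : Set β) : ℕ :=
  Nat.card (G.restrict F).toSimpleGraph.ConnectedComponent

open Classical in
/-- The Potts-model partition function of a finite multigraph `G = (V, E)`, in its
Fortuin-Kasteleyn (subgraph) form `Z_G(q, {v_e}) = ∑_{E' ⊆ E} q ^ k(E') * ∏_{e ∈ E'} v_e`. -/
noncomputable def pottsZ {α β : Type*} [Finite α] [Fintype β] (G : Graph α β)
    (q : ℂ) (v : β → ℂ) : ℂ :=
  ∑ F : Finset β with (F : Set β) ⊆ G.edgeSet,
    q ^ numComponents G (F : Set β) * ∏ e ∈ F, v e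

/-- The dichromatic polynomial `Z_G(q, v)`: all edge weights are equal to `v`. -/
noncomputable def dichromaticZ {α β : Type*} [Finite α] [Fintype β] (G : Graph α β)
    (q v : ℂ) : ℂ :=
  pottsZ G q (fun _ => v)

/-- The vertices of `Θ^(s,p)`: the endvertices `x = Sum.inl false` and `y = Sum.inl true`, and
the `s - 1` internal vertices of each of the `p` chains. -/
abbrev ThetaVertex (s p : ℕ) : Type := Bool ⊕ (Fin p × Fin (s - 1))

/-- The `k`-th vertex, `0 ≤ k ≤ s`, on the `i`-th chain of `Θ^(s,p)` (for `s ≥ 1`): it is `x` for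
`k = 0`, the `k`-th internal vertex for `0 < k < s`, and `y` for `k = s`. -/
def thetaChainVertex (s p : ℕ) (i : Fin p) (k : ℕ) : ThetaVertex s p :=
  if k = 0 then Sum.inl false
  else if h : k - 1 < s - 1 then Sum.inr (i, ⟨k - 1, h⟩)
  else Sum.inl true

/-- The generalized theta graph `Θ^(s,p)` (for `s ≥ 1`): the endvertices `x` and `y` are joined by
`p` internally disjoint chains of `s` edges each. The edge `(i, j)` is the `j`-th edge of the
`i`-th chain. For `s = 1` these are `p` parallel edges. -/
def thetaGraph (s p : ℕ) : Graph (ThetaVertex s p) (Fin p × Fin s) where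
  vertexSet := Set.univ
  IsLink e a b :=
    s(a, b) = s(thetaChainVertex s p e.1 e.2, thetaChainVertex s p e.1 (e.2 + 1))
  edgeSet := Set.univ
  isLink_symm _ _ := ⟨fun _ _ h => Sym2.eq_swap.trans h⟩
  eq_or_eq_of_isLink_of_isLink _ _ _ _ _ h h' := by
    have := h.trans h'.symm
    rw [Sym2.eq_iff] at this
    tauto
  edge_mem_iff_exists_isLink _ := ⟨fun _ => ⟨_, _, rfl⟩, fun _ => Set.mem_univ _⟩
  left_mem_of_isLink _ _ _ _ := Set.mem_univ _

/-! Splitting an edge subset chain by chain gives `Z = q(v^s + D)^p + (q² - q)D^p` with `qD =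
(q+v)^s - v^s` (`dichromaticZ_thetaGraph`, `mul_chainDisconnected`). Where `q` and `D` do not
vanish, `Z = 0` says `f^p = 1 - q` for `f = 1 + q v^s / ((q+v)^s - v^s)`. If `f` is not constant and
`q ≠ 1`, solutions accumulate, as `p → ∞`, at every point with `|f| = 1`.

It remains to find such points near a given one. Put `A = (q+v)/v`, so that `f = 1 + q/(A^s - 1)`.
Where `|A| > 1`, `f` is near `1` for large `s`, while the phase of `A^s` turns fast; hence `|f| = 1`
occurs close by. Both steps solve an equation `A^n = |A w|^n b_n` and rest on
`AnalyticAt.eventually_exists_pow_eq`. Finite nets then make the approximation uniform on the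
bounded region. -/

open Finset in
theorem Finset.card_filter_exists_lt {α : Type*} [LinearOrder α] (B : Finset α) :
    #{a ∈ B | ∃ b ∈ B, a < b} = #B - 1 := by
  rcases B.eq_empty_or_nonempty with rfl | hB
  · simp
  · have : {a ∈ B | ∃ b ∈ B, a < b} = B.erase (B.max' hB) := by
      ext a
      simp only [mem_filter, mem_erase]
      constructor
      · rintro ⟨ha, b, hb, hab⟩
        exact ⟨(hab.trans_le (B.le_max' b hb)).ne, ha⟩
      · rintro ⟨hne, ha⟩
        exact ⟨ha, _, B.max'_mem hB, lt_of_le_of_ne (B.le_max' a ha) hne⟩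
    rw [this, card_erase_of_mem (B.max'_mem hB)]

/-- If `f` is constant on components and separates the representatives `rep l`, `l ∈ S`, which meet
every component, then the number of components is the cardinality of `S`. -/
theorem SimpleGraph.card_connectedComponent_of_labelling {V L : Type*} (H : SimpleGraph V)
    (f : V → L) (S : Finset L) (rep : L → V) (hf : ∀ a b, H.Adj a b → f a = f b)
    (hrep : ∀ l ∈ S, f (rep l) = l) (hS : ∀ a, ∃ l ∈ S, H.Reachable a (rep l)) :
    Nat.card H.ConnectedComponent = S.card := by
  have hreach : ∀ a b, H.Reachable a b → f a = f b := by
    rintro a b ⟨w⟩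
    induction w with
    | nil => rfl
    | cons h _ ih => exact (hf _ _ h).trans ih
  have hbij : Function.Bijective
      (fun l : S => H.connectedComponentMk (rep l)) := by
    constructor
    · intro l l' h
      have := hreach _ _ (SimpleGraph.ConnectedComponent.exact h)
      rw [hrep _ l.2, hrep _ l'.2] at this
      exact Subtype.ext this
    · intro c
      induction c using SimpleGraph.ConnectedComponent.ind with
      | h a =>
        obtain ⟨l, hl, h⟩ := hS a
        exact ⟨⟨l, hl⟩, (SimpleGraph.ConnectedComponent.sound h).symm⟩
  rw [← Nat.card_congr (Equiv.ofBijective _ hbij)]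
  simp

-- The filtered sum in `pottsZ` elaborates to a sum over a `Finset (Set β)`, the image of `univ`
-- under coercion; injectivity of the coercion brings it back to finsets.
open Classical Finset in
theorem pottsZ_eq_sum {α β : Type*} [Finite α] [Fintype β] (G : Graph α β) (q : ℂ) (v : β → ℂ) :
    pottsZ G q v = ∑ F : Finset β, if (F : Set β) ⊆ G.edgeSet then
      q ^ numComponents G (F : Set β) * ∏ e ∈ F, v e else 0 := by
  have h : ((univ : Finset (Finset β)) >>= fun a => (pure (a : Set β) : Finset (Set β))) =
      univ.image ((↑) : Finset β → Set β) := by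
    ext F
    simp
  rw [pottsZ, h, sum_filter, sum_image (fun _ _ _ _ h => coe_injective h)]
  simp only [toFinset_coe]

/-! ### Components of spanning subgraphs of the theta graph. -/

section Theta

variable {s p : ℕ}

/-- The spanning subgraph of the theta graph with edge set `F`, as a simple graph. -/
abbrev thetaSub (F : Finset (Fin p × Fin s)) :
    SimpleGraph ((thetaGraph s p).restrict (F : Set (Fin p × Fin s))).vertexSet :=
  ((thetaGraph s p).restrict (F : Set (Fin p × Fin s))).toSimpleGraph

/-- A vertex of the theta graph, as a vertex of a spanning subgraph. -/
def thetaSubVertex (F : Finset (Fin p × Fin s)) (a : ThetaVertex s p) :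
    ((thetaGraph s p).restrict (F : Set (Fin p × Fin s))).vertexSet :=
  ⟨a, Set.mem_univ a⟩

theorem thetaSub_adj {F : Finset (Fin p × Fin s)} {a b : ThetaVertex s p} :
    (thetaSub F).Adj (thetaSubVertex F a) (thetaSubVertex F b) ↔
      a ≠ b ∧ ∃ e ∈ F, s(a, b) =
        s(thetaChainVertex s p e.1 e.2, thetaChainVertex s p e.1 (e.2 + 1)) := by
  simp only [thetaSub, Graph.toSimpleGraph_adj, thetaSubVertex, Graph.Adj, Graph.restrict_isLink,
    ne_eq]
  refine and_congr (not_congr Subtype.mk_eq_mk) ⟨?_, ?_⟩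
  · rintro ⟨e, he⟩
    exact ⟨e, he.1, he.2⟩
  · rintro ⟨e, he, h⟩
    exact ⟨e, he, h⟩

theorem thetaSub_reachable_step {F : Finset (Fin p × Fin s)} {i : Fin p} {j : Fin s}
    (h : (i, j) ∈ F) :
    (thetaSub F).Reachable (thetaSubVertex F (thetaChainVertex s p i j))
      (thetaSubVertex F (thetaChainVertex s p i (j + 1))) := by
  by_cases hab : thetaChainVertex s p i j = thetaChainVertex s p i (j + 1)
  · rw [← hab]
  · exact SimpleGraph.Adj.reachable (thetaSub_adj.2 ⟨hab, (i, j), h, rfl⟩)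

theorem thetaSub_reachable_of_forall {F : Finset (Fin p × Fin s)} {i : Fin p} {k m : ℕ}
    (hkm : k ≤ m) (hm : m ≤ s) (h : ∀ j : Fin s, k ≤ j → (j : ℕ) < m → (i, j) ∈ F) :
    (thetaSub F).Reachable (thetaSubVertex F (thetaChainVertex s p i k))
      (thetaSubVertex F (thetaChainVertex s p i m)) := by
  induction m, hkm using Nat.le_induction with
  | base => rfl
  | succ m hkm ih =>
    refine (ih (by omega) fun j h1 h2 => h j h1 (by omega)).trans ?_
    exact thetaSub_reachable_step (j := ⟨m, hm⟩) (h _ hkm (by simp))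

/-- The label of the component of `y`. -/
def thetaFarLabel (F : Finset (Fin p × Fin s)) : (Fin p × Fin s) ⊕ Bool :=
  if ∃ i, ∀ j, (i, j) ∈ F then Sum.inr false else Sum.inr true

/-- The label of the component of the `k`-th vertex of the `i`-th chain: a component containing
neither endvertex is labelled by the missing edge that precedes it. -/
def thetaChainLabel (F : Finset (Fin p × Fin s)) (i : Fin p) : ℕ → (Fin p × Fin s) ⊕ Bool
  | 0 => Sum.inr false
  | k + 1 =>
    if h : k < s then
      if (i, ⟨k, h⟩) ∈ F then thetaChainLabel F i k
      else if ∃ j : Fin s, k < j ∧ (i, j) ∉ F then Sum.inl (i, ⟨k, h⟩)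
      -- Nothing is missing after edge `k`, so the vertex is joined to `y`.
      else thetaFarLabel F
    -- Past the end of the chain the label stays constant.
    else thetaChainLabel F i k

/-- The label of the component of a vertex. -/
def thetaLabel (F : Finset (Fin p × Fin s)) : ThetaVertex s p → (Fin p × Fin s) ⊕ Bool
  | Sum.inl false => Sum.inr false
  | Sum.inl true => thetaFarLabel F
  | Sum.inr (i, k) => thetaChainLabel F i (k + 1)

/-- The labels that occur. -/
def thetaLabels (F : Finset (Fin p × Fin s)) : Finset ((Fin p × Fin s) ⊕ Bool) :=
  Finset.disjSum {e | e ∉ F ∧ ∃ j : Fin s, e.2 < j ∧ (e.1, j) ∉ F}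
    (if ∃ i, ∀ j, (i, j) ∈ F then {false} else {false, true})

/-- The vertex that represents a label. -/
def thetaRep : (Fin p × Fin s) ⊕ Bool → ThetaVertex s p
  | Sum.inl e => thetaChainVertex s p e.1 (e.2 + 1)
  | Sum.inr b => Sum.inl b

theorem thetaChainLabel_of_forall_mem {F : Finset (Fin p × Fin s)} {i : Fin p}
    (h : ∀ j, (i, j) ∈ F) (k : ℕ) : thetaChainLabel F i k = Sum.inr false := by
  induction k with
  | zero => rfl
  | succ k ih => simp [thetaChainLabel, h, ih]

theorem thetaChainLabel_eq_far {F : Finset (Fin p × Fin s)} {i : Fin p} {k : ℕ}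
    (h : ∃ j : Fin s, (j : ℕ) < k ∧ (i, j) ∉ F) (h' : ∀ j : Fin s, k ≤ j → (i, j) ∈ F) :
    thetaChainLabel F i k = thetaFarLabel F := by
  induction k with
  | zero => simp at h
  | succ k ih =>
    rw [thetaChainLabel]
    split_ifs with h1 h2 h3
    · apply ih
      · obtain ⟨j, hj, hjF⟩ := h
        refine ⟨j, lt_of_le_of_ne (by omega) ?_, hjF⟩
        rintro rfl
        exact hjF h2
      · intro j hj
        rcases hj.eq_or_lt with rfl | hj
        · exact h2
        · exact h' j hj
    · obtain ⟨j, hj, hjF⟩ := h3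
      exact absurd (h' j hj) hjF
    · rfl
    · apply ih
      · obtain ⟨j, hj, hjF⟩ := h
        exact ⟨j, by omega, hjF⟩
      · intro j hj
        omega

theorem thetaChainLabel_self (F : Finset (Fin p × Fin s)) (i : Fin p) :
    thetaChainLabel F i s = thetaFarLabel F := by
  by_cases h : ∀ j, (i, j) ∈ F
  · rw [thetaChainLabel_of_forall_mem h, thetaFarLabel, if_pos ⟨i, h⟩]
  · push Not at h
    obtain ⟨j, hj⟩ := h
    exact thetaChainLabel_eq_far ⟨j, j.2, hj⟩ fun j h => absurd j.2 (by omega)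

theorem thetaChainVertex_self (hs : 1 ≤ s) (i : Fin p) :
    thetaChainVertex s p i s = Sum.inl true := by
  rw [thetaChainVertex, if_neg (by omega), dif_neg (by omega)]

theorem thetaLabel_chainVertex (hs : 1 ≤ s) (F : Finset (Fin p × Fin s)) (i : Fin p) {k : ℕ}
    (hk : k ≤ s) : thetaLabel F (thetaChainVertex s p i k) = thetaChainLabel F i k := by
  rcases Nat.eq_zero_or_pos k with rfl | h0
  · rfl
  · rcases hk.eq_or_lt with rfl | hk
    · rw [thetaChainVertex_self hs, thetaChainLabel_self]
      rfl
    · rw [thetaChainVertex, if_neg h0.ne', dif_pos (by omega), thetaLabel]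
      congr 1
      simp only
      omega

theorem thetaLabel_eq_of_adj (hs : 1 ≤ s) (F : Finset (Fin p × Fin s)) {a b : ThetaVertex s p}
    (h : (thetaSub F).Adj (thetaSubVertex F a) (thetaSubVertex F b)) :
    thetaLabel F a = thetaLabel F b := by
  obtain ⟨-, ⟨i, j⟩, he, hab⟩ := thetaSub_adj.1 h
  have key : thetaLabel F (thetaChainVertex s p i j)
      = thetaLabel F (thetaChainVertex s p i (j + 1)) := by
    rw [thetaLabel_chainVertex hs F i j.2.le, thetaLabel_chainVertex hs F i (by omega),
      thetaChainLabel, dif_pos j.2, if_pos he]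
  rcases Sym2.eq_iff.1 hab with ⟨rfl, rfl⟩ | ⟨rfl, rfl⟩
  · exact key
  · exact key.symm

theorem thetaLabel_rep (hs : 1 ≤ s) (F : Finset (Fin p × Fin s))
    {l : (Fin p × Fin s) ⊕ Bool} (hl : l ∈ thetaLabels F) : thetaLabel F (thetaRep l) = l := by
  rcases l with ⟨i, j⟩ | b
  · simp only [thetaLabels, Finset.inl_mem_disjSum, Finset.mem_filter, Finset.mem_univ,
      true_and] at hl
    rw [thetaRep, thetaLabel_chainVertex hs F i (by simp only; omega), thetaChainLabel,
      dif_pos j.2, if_neg hl.1]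
    exact if_pos hl.2
  · cases b
    · rfl
    · simp only [thetaLabels, Finset.inr_mem_disjSum] at hl
      split_ifs at hl with h
      · simp at hl
      · rw [thetaRep, thetaLabel, thetaFarLabel, if_neg h]

theorem thetaLabel_exists_rep_far (hs : 1 ≤ s) (F : Finset (Fin p × Fin s)) :
    ∃ l ∈ thetaLabels F, (thetaSub F).Reachable (thetaSubVertex F (Sum.inl true))
      (thetaSubVertex F (thetaRep l)) := by
  by_cases h : ∃ i, ∀ j, (i, j) ∈ F
  · refine ⟨Sum.inr false, by simp [thetaLabels, h], ?_⟩
    obtain ⟨i, hi⟩ := h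
    have := thetaSub_reachable_of_forall (F := F) (i := i) (Nat.zero_le s) le_rfl
      fun j _ _ => hi j
    rw [thetaChainVertex_self hs] at this
    exact this.symm
  · exact ⟨Sum.inr true, by simp [thetaLabels, h], SimpleGraph.Reachable.refl _⟩

theorem thetaLabel_exists_rep_chain (hs : 1 ≤ s) (F : Finset (Fin p × Fin s)) (i : Fin p) {k : ℕ}
    (hk : k ≤ s) :
    ∃ l ∈ thetaLabels F, (thetaSub F).Reachable (thetaSubVertex F (thetaChainVertex s p i k))
      (thetaSubVertex F (thetaRep l)) := by
  induction k with
  | zero =>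
    refine ⟨Sum.inr false, ?_, SimpleGraph.Reachable.refl _⟩
    simp only [thetaLabels, Finset.inr_mem_disjSum]
    split_ifs <;> simp
  | succ k ih =>
    by_cases h1 : (i, ⟨k, hk⟩) ∈ F
    · obtain ⟨l, hl, h⟩ := ih (by omega)
      exact ⟨l, hl, (thetaSub_reachable_step h1).symm.trans h⟩
    · by_cases h2 : ∃ j : Fin s, k < j ∧ (i, j) ∉ F
      · refine ⟨Sum.inl (i, ⟨k, hk⟩), ?_, SimpleGraph.Reachable.refl _⟩
        simp only [thetaLabels, Finset.inl_mem_disjSum, Finset.mem_filter, Finset.mem_univ,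
          true_and]
        exact ⟨h1, h2⟩
      · push Not at h2
        obtain ⟨l, hl, h⟩ := thetaLabel_exists_rep_far hs F
        refine ⟨l, hl, SimpleGraph.Reachable.trans ?_ h⟩
        rw [← thetaChainVertex_self hs i]
        exact thetaSub_reachable_of_forall hk le_rfl fun j hj _ => h2 j hj

theorem thetaLabel_exists_rep (hs : 1 ≤ s) (F : Finset (Fin p × Fin s)) (a : ThetaVertex s p) :
    ∃ l ∈ thetaLabels F, (thetaSub F).Reachable (thetaSubVertex F a)
      (thetaSubVertex F (thetaRep l)) := by
  rcases a with (_ | _) | ⟨i, k⟩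
  · refine ⟨Sum.inr false, ?_, SimpleGraph.Reachable.refl _⟩
    simp only [thetaLabels, Finset.inr_mem_disjSum]
    split_ifs <;> simp
  · exact thetaLabel_exists_rep_far hs F
  · have := thetaLabel_exists_rep_chain hs F i (k := k + 1) (by omega)
    rwa [thetaChainVertex, if_neg (by omega), dif_pos (by omega)] at this

theorem numComponents_thetaGraph (hs : 1 ≤ s) (F : Finset (Fin p × Fin s)) :
    numComponents (thetaGraph s p) (F : Set (Fin p × Fin s)) = (thetaLabels F).card :=
  (thetaSub F).card_connectedComponent_of_labelling (fun a => thetaLabel F a.1) (thetaLabels F)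
    (fun l => thetaSubVertex F (thetaRep l)) (fun _ _ h => thetaLabel_eq_of_adj hs F h)
    (fun _ hl => thetaLabel_rep hs F hl) (fun a => thetaLabel_exists_rep hs F a.1)

-- A chain with `m ≥ 1` missing edges has `m - 1` components avoiding both endvertices, one after
-- each missing edge but the last. For a complete chain the truncated `0 - 1 = 0` is again the right
-- count.
open Finset in
theorem card_thetaLabels (A : Fin p → Finset (Fin s)) :
    #(thetaLabels (p := p) {e | e.2 ∈ A e.1}) =
      ∑ i, (#(A i)ᶜ - 1) + if ∃ i, A i = univ then 1 else 2 := by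
  rw [thetaLabels, card_disjSum]
  congr 1
  · rw [← univ_product_univ, card_filter, sum_product]
    refine sum_congr rfl fun i _ => ?_
    rw [← card_filter, ← card_filter_exists_lt]
    congr 1
    ext j
    simp [and_comm]
  · simp only [mem_filter, mem_univ, true_and, eq_univ_iff_forall]
    split_ifs <;> rfl

/-! ### Closed form of the partition function. -/

/-- Edge subsets of the theta graph as families of edge subsets of the chains. -/
def thetaEdgeEquiv (s p : ℕ) : (Fin p → Finset (Fin s)) ≃ Finset (Fin p × Fin s) where
  toFun A := {e | e.2 ∈ A e.1}
  invFun F i := {j | (i, j) ∈ F}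
  left_inv A := by ext; simp
  right_inv F := by ext; simp

open Finset in
theorem card_thetaEdgeEquiv (A : Fin p → Finset (Fin s)) :
    #(thetaEdgeEquiv s p A) = ∑ i, #(A i) := by
  rw [thetaEdgeEquiv, Equiv.coe_fn_mk, ← univ_product_univ, card_filter, sum_product]
  refine sum_congr rfl fun i _ => ?_
  simp

open Finset in
/-- The contribution to the partition function of the incomplete edge subsets of a chain. -/
noncomputable def chainDisconnected (s : ℕ) (q v : ℂ) : ℂ :=
  ∑ A ∈ univ.erase (univ : Finset (Fin s)), q ^ (#Aᶜ - 1) * v ^ #A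

open Finset in
theorem mul_chainDisconnected (s : ℕ) (q v : ℂ) :
    q * chainDisconnected s q v = (q + v) ^ s - v ^ s := by
  have h := Fintype.sum_pow_mul_eq_add_pow (Fin s) v q
  rw [Fintype.card_fin, ← add_sum_erase _ _ (mem_univ univ)] at h
  simp only [card_univ, Fintype.card_fin, tsub_self, pow_zero, mul_one] at h
  rw [add_comm q v, ← h, add_sub_cancel_left, chainDisconnected, mul_sum]
  refine sum_congr rfl fun A hA => ?_
  have : #Aᶜ ≠ 0 := by simpa using hA
  have hc : s - #A = #Aᶜ := by simp [card_compl]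
  obtain ⟨n, hn⟩ := Nat.exists_eq_succ_of_ne_zero this
  rw [hc, hn, Nat.succ_sub_one, pow_succ]
  ring

-- The factor beyond the chain weights is `q` if some chain is complete and `q²` otherwise.
-- Weighting all families by `q` leaves the correction `q² - q` for those without a complete chain;
-- both sums factor over the chains.
open Finset in
theorem dichromaticZ_thetaGraph (hs : 1 ≤ s) (q v : ℂ) :
    dichromaticZ (thetaGraph s p) q v =
      q * (v ^ s + chainDisconnected s q v) ^ p
        + (q ^ 2 - q) * chainDisconnected s q v ^ p := by
  classical
  have hall : v ^ s + chainDisconnected s q v = ∑ A : Finset (Fin s), q ^ (#Aᶜ - 1) * v ^ #A := by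
    rw [← add_sum_erase _ _ (mem_univ univ), chainDisconnected]
    simp
  have h1 : (v ^ s + chainDisconnected s q v) ^ p =
      ∑ A : Fin p → Finset (Fin s), ∏ i, q ^ (#(A i)ᶜ - 1) * v ^ #(A i) := by
    rw [hall, ← Fin.prod_const, Finset.prod_univ_sum, Fintype.piFinset_univ]
  have h2 : chainDisconnected s q v ^ p =
      ∑ A : Fin p → Finset (Fin s), if ∃ i, A i = univ then 0 else
        ∏ i, q ^ (#(A i)ᶜ - 1) * v ^ #(A i) := by
    rw [chainDisconnected, ← Fin.prod_const, Finset.prod_univ_sum]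
    simp_rw [← ite_not (∃ i, _)]
    rw [← sum_filter]
    refine sum_congr ?_ fun _ _ => rfl
    ext A
    simp [Fintype.mem_piFinset]
  rw [h1, h2, mul_sum, mul_sum, ← sum_add_distrib, dichromaticZ, pottsZ_eq_sum]
  simp_rw [if_pos (show _ ⊆ (thetaGraph s p).edgeSet from Set.subset_univ _)]
  rw [← (thetaEdgeEquiv s p).sum_comp]
  refine sum_congr rfl fun A _ => ?_
  rw [numComponents_thetaGraph hs, prod_const, card_thetaEdgeEquiv]
  have := card_thetaLabels A
  rw [thetaEdgeEquiv, Equiv.coe_fn_mk, this, prod_mul_distrib, prod_pow_eq_pow_sum,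
    prod_pow_eq_pow_sum, pow_add]
  split_ifs <;> ring

theorem pow_mul_dichromaticZ_thetaGraph (hs : 1 ≤ s) (q v : ℂ) :
    q ^ p * dichromaticZ (thetaGraph s p) q v =
      q * (((q + v) ^ s - v ^ s + q * v ^ s) ^ p + (q - 1) * ((q + v) ^ s - v ^ s) ^ p) := by
  rw [dichromaticZ_thetaGraph hs, ← mul_chainDisconnected, ← mul_add, mul_pow, mul_pow,
    add_comm (v ^ s)]
  ring

end Theta

/-! ### Zeros from power equations. -/

open Filter Topology Metric in
/-- Near a point `w` at which `A` is not locally constant, the equation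
`A ζ ^ n = ‖A w‖ ^ n * b n ζ` is solvable for all large `n`, provided that `b n` stays away
from `0` and `∞`. -/
theorem AnalyticAt.eventually_exists_pow_eq {w K : ℂ} {A : ℂ → ℂ} {b : ℕ → ℂ → ℂ}
    (hA : AnalyticAt ℂ A w) (hA0 : A w ≠ 0) (hne : ¬ ∀ᶠ ζ in 𝓝 w, A ζ = A w)
    (hb : ∀ n, Differentiable ℂ (b n)) (hK : K ≠ 0)
    (hlim : Tendsto (Function.uncurry b) (atTop ×ˢ 𝓝 w) (𝓝 K)) {ε : ℝ} (hε : 0 < ε) :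
    ∀ᶠ n in atTop, ∃ ζ, ‖ζ - w‖ < ε ∧ A ζ ^ n = (‖A w‖ : ℂ) ^ n * b n ζ := by
  have h1 : ∀ᶠ ζ in 𝓝 w, A ζ / A w ∈ Complex.slitPlane := by
    have : Tendsto (fun ζ => A ζ / A w) (𝓝 w) (𝓝 (A w / A w)) :=
      hA.continuousAt.tendsto.div_const _
    rw [div_self hA0] at this
    exact this.eventually (Complex.isOpen_slitPlane.mem_nhds Complex.one_mem_slitPlane)
  have h2 : ∀ᶠ ζ in 𝓝 w, DifferentiableAt ℂ A ζ :=
    hA.eventually_analyticAt.mono fun ζ h => h.differentiableAt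
  have h3 : ∀ᶠ ζ in 𝓝 w, ζ ≠ w → A ζ ≠ A w :=
    eventually_nhdsWithin_iff.1
      ((hA.eventually_eq_or_eventually_ne analyticAt_const).resolve_left hne)
  -- Joint convergence gives one disc around `w` on which `log (b n / K)` is defined for all large
  -- `n`.
  have h4 : ∀ᶠ x : ℕ × ℂ in atTop ×ˢ 𝓝 w, ‖b x.1 x.2 / K - 1‖ < 1 / 2 := by
    have := hlim.div_const K
    rw [div_self hK] at this
    filter_upwards [this.eventually (ball_mem_nhds 1 (by norm_num : (0 : ℝ) < 1 / 2))] with x hx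
    exact (dist_eq_norm _ _).symm.trans_lt hx
  obtain ⟨P, hP, Q, hQ, hPQ⟩ := eventually_prod_iff.1 h4
  obtain ⟨r₀, hr₀, hball⟩ := Metric.eventually_nhds_iff_ball.1 (h1.and (h2.and (h3.and hQ)))
  set r := min r₀ ε / 2 with hr
  have hr0 : 0 < r := by positivity
  have hrr : r < r₀ := by have := min_le_left r₀ ε; linarith
  have hrε : r < ε := by have := min_le_right r₀ ε; linarith
  have hsub : closedBall w r ⊆ ball w r₀ := closedBall_subset_ball hrr
  set L : ℂ → ℂ := fun ζ => Complex.log (A ζ / A w) with hL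
  have hLw : L w = 0 := by simp [hL]
  have hLd : DifferentiableOn ℂ L (ball w r₀) := fun ζ hζ =>
    (((hball ζ hζ).2.1.div_const _).clog (hball ζ hζ).1).differentiableWithinAt
  have hexpL : ∀ ζ ∈ ball w r₀, Complex.exp (L ζ) = A ζ / A w := fun ζ hζ =>
    Complex.exp_log (Complex.slitPlane_ne_zero (hball ζ hζ).1)
  obtain ⟨m, hm, hmL⟩ := (isCompact_sphere w r).exists_forall_le' (f := fun ζ => ‖L ζ‖) (a := 0)
    (hLd.continuousOn.norm.mono (sphere_subset_closedBall.trans hsub)) (by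
      intro ζ hζ
      have hζ' := hsub (sphere_subset_closedBall hζ)
      rw [norm_pos_iff]
      intro h0
      have h := hexpL ζ hζ'
      rw [h0, Complex.exp_zero, eq_div_iff hA0, one_mul] at h
      refine (hball ζ hζ').2.2.1 ?_ h.symm
      rintro rfl
      rw [mem_sphere, dist_self] at hζ
      exact hr0.ne hζ)
  set θ := Complex.arg (A w) with hθ
  set M := Real.pi + ‖Complex.log K‖ with hM
  have hM0 : 0 < M := by positivity
  have hlarge : ∀ᶠ n : ℕ in atTop, 8 * (M + 2) / m < n :=
    tendsto_natCast_atTop_atTop.eventually_gt_atTop _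
  filter_upwards [hlarge, hP] with n hn hPn
  have hn0 : (0 : ℝ) < n := lt_of_le_of_lt (by positivity) hn
  have hn0' : (n : ℂ) ≠ 0 := by exact_mod_cast hn0.ne'
  have hnm : (M + 2) / n < m / 8 := by
    rw [div_lt_iff₀ hm] at hn
    rw [div_lt_iff₀ hn0]
    linarith
  have hbK : ∀ ζ ∈ ball w r₀, ‖b n ζ / K - 1‖ < 1 / 2 := fun ζ hζ =>
    hPQ hPn (hball ζ hζ).2.2.2
  have hbslit : ∀ ζ ∈ ball w r₀, b n ζ / K ∈ Complex.slitPlane := fun ζ hζ =>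
    Complex.ball_one_subset_slitPlane (by
      rw [mem_ball, dist_eq_norm]; exact (hbK ζ hζ).trans (by norm_num))
  set l : ℂ → ℂ := fun ζ => Complex.log (b n ζ / K) with hl
  have hld : DifferentiableOn ℂ l (ball w r₀) := fun ζ hζ =>
    (((hb n ζ).div_const _).clog (hbslit ζ hζ)).differentiableWithinAt
  have hlnorm : ∀ ζ ∈ ball w r₀, ‖l ζ‖ ≤ 1 := fun ζ hζ => by
    have h := Complex.norm_log_one_add_half_le_self (hbK ζ hζ).le
    rw [add_sub_cancel] at h
    have := hbK ζ hζ
    simp only [hl]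
    linarith
  have hln : ∀ ζ ∈ ball w r₀, ‖l ζ / n‖ ≤ 1 / n := fun ζ hζ => by
    rw [norm_div, Complex.norm_natCast]
    gcongr
    exact hlnorm ζ hζ
  -- With `θ = arg (A w)`, the equation becomes `n * G ζ = log K - nθi` modulo `2πi`.
  set G : ℂ → ℂ := fun ζ => L ζ - l ζ / n with hG
  have hGd : DifferentiableOn ℂ G (ball w r₀) := hLd.sub (hld.div_const _)
  have hw : w ∈ ball w r₀ := mem_ball_self hr₀
  have hMn : M / n + 2 / n < m / 8 := by rw [← add_div]; exact hnm
  have hMn0 : 0 < M / n := by positivity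
  have h21 : 2 / (n : ℝ) = 1 / n + 1 / n := by ring
  have hn1 : 0 < 1 / (n : ℝ) := by positivity
  have hGw : ‖G w‖ ≤ 1 / n := by
    simpa only [hG, hLw, zero_sub, norm_neg] using hln w hw
  have hsphere : ∀ ζ ∈ sphere w r, m / 2 ≤ ‖G ζ - G w‖ := by
    intro ζ hζ
    have e1 := hmL ζ hζ
    have e2 := hln ζ (hsub (sphere_subset_closedBall hζ))
    have e3 : ‖L ζ‖ ≤ ‖G ζ - G w‖ + ‖l ζ / n‖ + ‖G w‖ := by
      have : L ζ = (G ζ - G w) + l ζ / n + G w := by simp only [hG]; ring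
      conv_lhs => rw [this]
      exact norm_add₃_le
    linarith
  have hfreq : ∃ᶠ ζ in 𝓝 w, G ζ ≠ G w := by
    intro hev
    simp only [not_not] at hev
    have hconst := (hGd.analyticOnNhd isOpen_ball).eqOn_of_preconnected_of_eventuallyEq
      analyticOnNhd_const (convex_ball w r₀).isPreconnected hw hev
    have hmem : w + r ∈ sphere w r := by simp [abs_of_pos hr0]
    have h5 := hsphere _ hmem
    rw [hconst (hsub (sphere_subset_closedBall hmem)), sub_self, norm_zero] at h5
    linarith
  have hdiff : DiffContOnCl ℂ G (ball w r) :=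
    (hGd.mono ((closure_ball_subset_closedBall).trans hsub)).diffContOnCl
  -- Quantitative open mapping: the image contains a ball about `G w` of radius `m / 4`, independent
  -- of `n`, whereas the target `c` and `G w` are both `O(1/n)`.
  have himage := hdiff.ball_subset_image_closedBall hr0 hsphere hfreq
  -- The nearest multiple of `2π` leaves a phase of at most `π`, whence the constant `M`.
  set k : ℤ := round (n * θ / (2 * Real.pi)) with hk
  set c : ℂ := ((2 * Real.pi * k - n * θ : ℝ) * Complex.I + Complex.log K) / n with hc
  have hcn : ‖c‖ ≤ M / n := by
    rw [hc, norm_div, Complex.norm_natCast]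
    gcongr
    refine (norm_add_le _ _).trans ?_
    rw [hM, norm_mul, Complex.norm_I, mul_one, Complex.norm_real, Real.norm_eq_abs]
    gcongr
    have h6 := abs_sub_round (n * θ / (2 * Real.pi))
    rw [← hk] at h6
    have h7 : 2 * Real.pi * k - n * θ
        = -(2 * Real.pi) * (n * θ / (2 * Real.pi) - k) := by
      field_simp
      ring
    rw [h7, abs_mul, abs_neg, abs_of_pos Real.two_pi_pos]
    nlinarith [Real.pi_pos]
  have hcmem : c ∈ ball (G w) (m / 2 / 2) := by
    rw [mem_ball, dist_eq_norm]
    have := norm_sub_le c (G w)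
    linarith
  obtain ⟨ζ, hζ, hGζ⟩ := himage hcmem
  have hζ0 := hsub hζ
  refine ⟨ζ, ?_, ?_⟩
  · rw [← dist_eq_norm]
    exact lt_of_le_of_lt hζ hrε
  · have e1 : (n : ℂ) * L ζ = l ζ + Complex.log K + k * (2 * Real.pi * Complex.I)
        - n * (θ * Complex.I) := by
      have : L ζ = c + l ζ / n := by rw [← hGζ]; simp only [hG]; ring
      rw [this, hc]
      push_cast
      field_simp
      ring
    have e2 := congrArg Complex.exp e1
    rw [Complex.exp_nat_mul, hexpL ζ hζ0, Complex.exp_sub, Complex.exp_add, Complex.exp_add,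
      Complex.exp_int_mul_two_pi_mul_I, Complex.exp_log hK,
      Complex.exp_log (Complex.slitPlane_ne_zero (hbslit ζ hζ0)), Complex.exp_nat_mul,
      div_mul_cancel₀ _ hK, mul_one, div_pow, div_eq_div_iff (pow_ne_zero _ hA0)
      (pow_ne_zero _ (Complex.exp_ne_zero _))] at e2
    have e3 : A w ^ n = (‖A w‖ : ℂ) ^ n * Complex.exp (θ * Complex.I) ^ n := by
      rw [← mul_pow, Complex.norm_mul_exp_arg_mul_I]
    rw [e3] at e2
    refine mul_right_cancel₀ (pow_ne_zero n (Complex.exp_ne_zero (θ * Complex.I))) ?_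
    rw [e2]
    ring

open Filter Topology in
/-- Let `Q`, `V` be entire functions and `w` a point with `Q w ∉ {0, 1}`, `V w ≠ 0` and
`‖V w‖ < ‖Q w + V w‖`. Under nondegeneracy assumptions, `w` is a limit of zeros of
`x ↦ Z_Θ(Q x, V x)` as first `p` and then `s` tends to infinity. -/
theorem eventually_exists_dichromaticZ_thetaGraph_eq_zero {Q V : ℂ → ℂ} {w : ℂ}
    (hQ : Differentiable ℂ Q) (hV : Differentiable ℂ V)
    (hratio : ∀ x c, ¬ ∀ᶠ ζ in 𝓝 x, Q ζ + V ζ = c * V ζ)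
    (hmod : ∀ s ≥ 2, ∀ x c, ¬ ∀ᶠ ζ in 𝓝 x, Q ζ * V ζ ^ s = c * ((Q ζ + V ζ) ^ s - V ζ ^ s))
    (hw0 : Q w ≠ 0) (hw1 : Q w ≠ 1) (hwV : V w ≠ 0) (hwQV : ‖V w‖ < ‖Q w + V w‖)
    {ε : ℝ} (hε : 0 < ε) :
    ∀ᶠ s in atTop, ∀ᶠ p in atTop,
      ∃ x, ‖x - w‖ < ε ∧ dichromaticZ (thetaGraph s p) (Q x) (V x) = 0 := by
  have hgood : ∀ᶠ ζ in 𝓝 w, (‖ζ - w‖ < ε ∧ Q ζ ≠ 0) ∧ Q ζ ≠ 1 ∧ V ζ ≠ 0 := by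
    have hcont : Continuous fun ζ => ‖ζ - w‖ := by fun_prop
    have h0 : ∀ᶠ ζ in 𝓝 w, ‖ζ - w‖ < ε :=
      hcont.continuousAt.eventually_lt continuousAt_const (by simpa using hε)
    exact (h0.and (hQ.continuous.continuousAt.eventually_ne hw0)).and
      ((hQ.continuous.continuousAt.eventually_ne hw1).and
        (hV.continuous.continuousAt.eventually_ne hwV))
  obtain ⟨δ, hδ, hball⟩ := Metric.eventually_nhds_iff.1 hgood
  set A : ℂ → ℂ := fun ζ => (Q ζ + V ζ) / V ζ with hA
  have hAw : 1 < ‖A w‖ := by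
    rw [hA, norm_div]
    exact (one_lt_div (norm_pos_iff.2 hwV)).2 hwQV
  have hA0 : A w ≠ 0 := norm_pos_iff.1 (zero_lt_one.trans hAw)
  have hAan : AnalyticAt ℂ A w :=
    ((hQ.add hV).analyticAt w).div (hV.analyticAt w) hwV
  have hAne : ¬ ∀ᶠ ζ in 𝓝 w, A ζ = A w := by
    intro h
    refine hratio w (A w) ?_
    filter_upwards [h, hV.continuous.continuousAt.eventually_ne hwV] with ζ h hζ
    rw [← h, hA, div_mul_cancel₀ _ hζ]
  -- Chosen so that `A^s = ‖A w‖^s * b s` reads `A^s = 1 - Q z` with `z = 1/2 + i‖A w‖^s`.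
  set b : ℕ → ℂ → ℂ := fun n ζ => -Complex.I * Q ζ + (1 - Q ζ / 2) * ((‖A w‖ : ℂ) ^ n)⁻¹ with hb
  have hbd : ∀ n, Differentiable ℂ (b n) := by
    intro n
    simp only [hb]
    fun_prop
  have hblim : Tendsto (Function.uncurry b) (atTop ×ˢ 𝓝 w)
      (𝓝 (-Complex.I * Q w + (1 - Q w / 2) * 0)) := by
    have hQt : Tendsto (fun x : ℕ × ℂ => Q x.2) (atTop ×ˢ 𝓝 w) (𝓝 (Q w)) :=
      hQ.continuous.continuousAt.tendsto.comp tendsto_snd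
    have hpow : Tendsto (fun x : ℕ × ℂ => ((‖A w‖ : ℂ) ^ x.1)⁻¹) (atTop ×ˢ 𝓝 w) (𝓝 0) := by
      have h : Tendsto (fun n : ℕ => ((‖A w‖ : ℂ) ^ n)⁻¹) atTop (𝓝 0) := by
        simp_rw [← inv_pow]
        apply tendsto_pow_atTop_nhds_zero_of_norm_lt_one
        rw [norm_inv, Complex.norm_real, norm_norm]
        exact inv_lt_one_of_one_lt₀ hAw
      exact h.comp tendsto_fst
    exact (hQt.const_mul _).add ((tendsto_const_nhds.sub (hQt.div_const 2)).mul hpow)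
  rw [mul_zero, add_zero] at hblim
  have hstep := hAan.eventually_exists_pow_eq hA0 hAne hbd
    (mul_ne_zero (neg_ne_zero.2 Complex.I_ne_zero) hw0) hblim hδ
  filter_upwards [hstep, eventually_ge_atTop 2] with s hs hs2
  obtain ⟨u, hu, hAu⟩ := hs
  obtain ⟨⟨huε, hu0⟩, hu1, huV⟩ := hball (y := u) (by rwa [dist_eq_norm])
  set c : ℝ := ‖A w‖ ^ s with hc
  have hcpos : 0 < c := by positivity
  have hc0 : (c : ℂ) ≠ 0 := by exact_mod_cast hcpos.ne'
  have hAu' : A u ^ s = -Complex.I * Q u * c + (1 - Q u / 2) := by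
    rw [hAu]
    simp only [hb]
    rw [← Complex.ofReal_pow, ← hc]
    field_simp
  have hnum : (Q u + V u) ^ s = V u ^ s * (-Complex.I * Q u * c + (1 - Q u / 2)) := by
    rw [← hAu', hA, div_pow, mul_div_cancel₀ _ (pow_ne_zero _ huV)]
  -- Here `f u = 1 - 1/z`, which is unimodular because `Re z = 1/2`.
  set z : ℂ := 1 / 2 + c * Complex.I with hz
  have hzre : z.re = 1 / 2 := by simp [hz]
  have hz0 : z ≠ 0 := by
    intro h
    rw [h] at hzre
    norm_num at hzre
  have hden : (Q u + V u) ^ s - V u ^ s = -(V u ^ s * Q u * z) := by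
    rw [hnum, hz]
    ring
  have hden0 : (Q u + V u) ^ s - V u ^ s ≠ 0 := by
    rw [hden]
    exact neg_ne_zero.2 (mul_ne_zero (mul_ne_zero (pow_ne_zero _ huV) hu0) hz0)
  set f : ℂ → ℂ := fun ζ => 1 + Q ζ * V ζ ^ s / ((Q ζ + V ζ) ^ s - V ζ ^ s) with hf
  have hfu : f u = -(starRingEnd ℂ z) / z := by
    have hstar : starRingEnd ℂ z = 1 - z := by
      rw [hz]
      apply Complex.ext <;> (simp; try norm_num)
    rw [hstar]
    simp only [hf]
    rw [hden]
    have := pow_ne_zero s huV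
    field_simp
    ring
  have hfnorm : ‖f u‖ = 1 := by
    rw [hfu, norm_div, norm_neg, Complex.norm_conj, div_self (norm_ne_zero_iff.2 hz0)]
  have hfan : AnalyticAt ℂ f u := by
    have h1 : AnalyticAt ℂ Q u := hQ.analyticAt u
    have h2 : AnalyticAt ℂ V u := hV.analyticAt u
    exact analyticAt_const.add ((h1.mul (h2.pow s)).div (((h1.add h2).pow s).sub (h2.pow s)) hden0)
  have hdenev : ∀ᶠ ζ in 𝓝 u, (Q ζ + V ζ) ^ s - V ζ ^ s ≠ 0 := by
    have hcont : Continuous fun ζ => (Q ζ + V ζ) ^ s - V ζ ^ s :=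
      ((hQ.continuous.add hV.continuous).pow s).sub (hV.continuous.pow s)
    exact hcont.continuousAt.eventually_ne hden0
  have hfne : ¬ ∀ᶠ ζ in 𝓝 u, f ζ = f u := by
    intro h
    refine hmod s hs2 u (f u - 1) ?_
    filter_upwards [h, hdenev] with ζ h hζ
    rw [← h]
    simp only [hf]
    rw [add_sub_cancel_left, div_mul_cancel₀ _ hζ]
  have hnear : ∀ᶠ ζ in 𝓝 u, (‖ζ - w‖ < ε ∧ Q ζ ≠ 0) ∧ (Q ζ + V ζ) ^ s - V ζ ^ s ≠ 0 := by
    have hcont : Continuous fun ζ => ‖ζ - w‖ := by fun_prop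
    exact ((hcont.continuousAt.eventually_lt continuousAt_const huε).and
      (hQ.continuous.continuousAt.eventually_ne hu0)).and hdenev
  obtain ⟨η, hη, hballu⟩ := Metric.eventually_nhds_iff.1 hnear
  have hlim : Tendsto (Function.uncurry fun (_ : ℕ) ζ => 1 - Q ζ) (atTop ×ˢ 𝓝 u)
      (𝓝 (1 - Q u)) :=
    tendsto_const_nhds.sub (hQ.continuous.continuousAt.tendsto.comp tendsto_snd)
  -- Second use, at `u` with `‖f u‖ = 1`: the equation is now `f^p = 1 - Q`.
  have hstep' := hfan.eventually_exists_pow_eq (norm_ne_zero_iff.1 (by rw [hfnorm]; exact one_ne_zero))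
    hfne (fun _ => hQ.const_sub 1) (sub_ne_zero.2 hu1.symm) hlim hη
  filter_upwards [hstep'] with p hp
  obtain ⟨x, hxu, hx⟩ := hp
  obtain ⟨⟨hxε, hx0⟩, hxden⟩ := hballu (y := x) (by rwa [dist_eq_norm])
  refine ⟨x, hxε, ?_⟩
  have hZ := pow_mul_dichromaticZ_thetaGraph (p := p) (one_le_two.trans hs2) (Q x) (V x)
  have hfx : (Q x + V x) ^ s - V x ^ s + Q x * V x ^ s
      = f x * ((Q x + V x) ^ s - V x ^ s) := by
    simp only [hf]
    field_simp
  rw [hfx, mul_pow, hx, hfnorm, Complex.ofReal_one, one_pow] at hZ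
  have hZ0 : Q x ^ p * dichromaticZ (thetaGraph s p) (Q x) (V x) = 0 := by
    rw [hZ]
    ring
  exact (mul_eq_zero.1 hZ0).resolve_left (pow_ne_zero _ hx0)

/-! ### Uniformity and approximation from the open region. -/

open Filter in
/-- If points arbitrarily close to each point of a totally bounded set `S` are limits of points
satisfying `P s p`, then the approximation is uniform on `S`. -/
theorem TotallyBounded.exists_uniform_approx {P : ℕ → ℕ → ℂ → Prop} {S : Set ℂ}
    (hS : TotallyBounded S)
    (h : ∀ x ∈ S, ∀ δ > 0, ∃ w, ‖w - x‖ < δ ∧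
      ∀ ε > 0, ∀ᶠ s in atTop, ∀ᶠ p in atTop, ∃ y, ‖y - w‖ < ε ∧ P s p y)
    {ε : ℝ} (hε : 0 < ε) :
    ∃ (s₀ : ℕ) (p₀ : ℕ → ℕ), ∀ s, s₀ ≤ s → ∀ p, p₀ s ≤ p →
      ∀ x ∈ S, ∃ y, P s p y ∧ ‖y - x‖ < ε := by
  have h3 : 0 < ε / 3 := by positivity
  obtain ⟨t, htS, htfin, hcover⟩ := Metric.finite_approx_of_totallyBounded hS (ε / 3) h3
  have hev : ∀ᶠ s in atTop, ∀ᶠ p in atTop, ∀ a ∈ t, ∃ y, ‖y - a‖ < ε / 3 + ε / 3 ∧ P s p y := by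
    have : ∀ᶠ s in atTop, ∀ a ∈ t, ∀ᶠ p in atTop,
        ∃ y, ‖y - a‖ < ε / 3 + ε / 3 ∧ P s p y := by
      -- Finiteness of the net lets one threshold serve all its points.
      rw [htfin.eventually_all]
      intro a ha
      obtain ⟨w, hwa, hw⟩ := h a (htS ha) (ε / 3) h3
      filter_upwards [hw (ε / 3) h3] with s hs
      filter_upwards [hs] with p hp
      obtain ⟨y, hy, hP⟩ := hp
      refine ⟨y, ?_, hP⟩
      rw [← sub_add_sub_cancel y w a]
      exact (norm_add_le _ _).trans_lt (add_lt_add hy hwa)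
    filter_upwards [this] with s hs
    rwa [htfin.eventually_all]
  obtain ⟨s₀, hs₀⟩ := eventually_atTop.1 hev
  choose! p₀ hp₀ using fun s hs => eventually_atTop.1 (hs₀ s hs)
  refine ⟨s₀, p₀, fun s hs p hp x hx => ?_⟩
  obtain ⟨a, ha, hxa⟩ := Set.mem_iUnion₂.1 (hcover hx)
  obtain ⟨y, hy, hP⟩ := hp₀ s hs p hp a ha
  refine ⟨y, hP, ?_⟩
  rw [Metric.mem_ball, dist_eq_norm, norm_sub_rev] at hxa
  rw [← sub_add_sub_cancel y a x]
  refine (norm_add_le _ _).trans_lt ?_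
  linarith

theorem totallyBounded_of_norm_le {S : Set ℂ} {R : ℝ} (h : ∀ x ∈ S, ‖x‖ ≤ R) :
    TotallyBounded S :=
  (isCompact_closedBall (0 : ℂ) R).totallyBounded.subset fun x hx => by simpa using h x hx

/-- An open condition that is satisfied at points `x + t d` for all small `t > 0` is satisfied at
points arbitrarily close to `x` and different from a given one. -/
theorem exists_norm_sub_lt_and_ne {U : Set ℂ} (hU : IsOpen U) {x d : ℂ}
    (h : ∀ t : ℝ, 0 < t → x + t * d ∈ U) (a : ℂ) {δ : ℝ} (hδ : 0 < δ) :
    ∃ w ∈ U, w ≠ a ∧ ‖w - x‖ < δ := by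
  have hmem : x + (δ / (2 * (‖d‖ + 1)) : ℝ) * d ∈ U ∩ Metric.ball x δ := by
    refine ⟨h _ (by positivity), ?_⟩
    rw [Metric.mem_ball, dist_eq_norm, add_sub_cancel_left, norm_mul, Complex.norm_real,
      Real.norm_of_nonneg (by positivity), div_mul_eq_mul_div, div_lt_iff₀ (by positivity)]
    nlinarith [norm_nonneg d]
  obtain ⟨w, ⟨hwU, hw⟩, hwa⟩ :=
    (dense_compl_singleton a).inter_open_nonempty _ (hU.inter Metric.isOpen_ball) ⟨_, hmem⟩
  exact ⟨w, hwU, hwa, by rwa [Metric.mem_ball, dist_eq_norm] at hw⟩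

open Filter Topology in
theorem Differentiable.eq_of_eventually_eq {f g : ℂ → ℂ} (hf : Differentiable ℂ f)
    (hg : Differentiable ℂ g) {x : ℂ} (h : ∀ᶠ ζ in 𝓝 x, f ζ = g ζ) (ζ : ℂ) : f ζ = g ζ :=
  congrFun (AnalyticOnNhd.eq_of_eventuallyEq (fun z _ => hf.analyticAt z)
    (fun z _ => hg.analyticAt z) h) ζ

theorem theorem1p4 :
    (∀ v₀ : ℂ, v₀ ≠ 0 → ∀ ε : ℝ, 0 < ε → ∀ R : ℝ,
      ∃ (s₀ : ℕ) (p₀ : ℕ → ℕ), ∀ s : ℕ, s₀ ≤ s → ∀ p : ℕ, p₀ s ≤ p →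
        ∀ q : ℂ, ‖v₀‖ ≤ ‖q + v₀‖ → ‖q‖ ≤ R →
          ∃ q' : ℂ, dichromaticZ (thetaGraph s p) q' v₀ = 0 ∧ ‖q' - q‖ < ε) ∧
    (∀ q₀ : ℂ, q₀ ≠ 1 → ∀ ε : ℝ, 0 < ε → ∀ R : ℝ,
      ∃ (s₀ : ℕ) (p₀ : ℕ → ℕ), ∀ s : ℕ, s₀ ≤ s → ∀ p : ℕ, p₀ s ≤ p →
        ∀ v : ℂ, ‖v‖ ≤ ‖q₀ + v‖ → ‖v‖ ≤ R →
          ∃ v' : ℂ, dichromaticZ (thetaGraph s p) q₀ v' = 0 ∧ ‖v' - v‖ < ε) := by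
  constructor
  · intro v₀ hv₀ ε hε R
    have key := fun H => TotallyBounded.exists_uniform_approx (ε := ε)
      (P := fun s p q => dichromaticZ (thetaGraph s p) q v₀ = 0)
      (S := {q | ‖v₀‖ ≤ ‖q + v₀‖ ∧ ‖q‖ ≤ R})
      (totallyBounded_of_norm_le fun x hx => hx.2) H hε
    suffices H : _ by
      obtain ⟨s₀, p₀, h⟩ := key H
      exact ⟨s₀, p₀, fun s hs p hp q h1 h2 => h s hs p hp q ⟨h1, h2⟩⟩
    intro q hq δ hδ
    have hU : IsOpen {q : ℂ | ‖v₀‖ < ‖q + v₀‖} := isOpen_lt (by fun_prop) (by fun_prop)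
    -- Scaling `q + v₀` by `1 + t` makes the inequality strict; `w ≠ 1` keeps `1 - q` nonzero.
    obtain ⟨w, hwU, hw1, hwδ⟩ := exists_norm_sub_lt_and_ne hU (x := q) (d := q + v₀) (by
      intro t ht
      have e : q + t * (q + v₀) + v₀ = ((1 + t : ℝ) : ℂ) * (q + v₀) := by push_cast; ring
      have hpos := norm_pos_iff.2 hv₀
      have hq1 := hq.1
      rw [Set.mem_ofPred_eq, e, norm_mul, Complex.norm_real,
        Real.norm_of_nonneg (by positivity)]
      nlinarith) 1 hδ
    refine ⟨w, hwδ, fun ε' hε' => ?_⟩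
    refine eventually_exists_dichromaticZ_thetaGraph_eq_zero (Q := fun q => q)
      (V := fun _ => v₀) differentiable_id (differentiable_const _) ?_ ?_ ?_ hw1 hv₀ hwU hε'
    · intro x c hx
      have hall := Differentiable.eq_of_eventually_eq (by fun_prop) (by fun_prop) hx
      have e0 := hall 0
      have e1 := hall 1
      simp [← e0] at e1
    · intro s hs x c hx
      have hall := Differentiable.eq_of_eventually_eq (by fun_prop) (by fun_prop) hx
      -- At `q + v₀ = v₀ω` only the right side vanishes, as `ω ≠ 1` for `s ≥ 2`. For `s = 1`, `f`
      -- would be the constant `1 + v₀`.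
      have hprim := Complex.isPrimitiveRoot_exp s (by omega)
      set ω := Complex.exp (2 * Real.pi * Complex.I / s)
      have e := hall (v₀ * (ω - 1))
      have e' : v₀ * (ω - 1) + v₀ = v₀ * ω := by ring
      simp only [e', mul_pow, hprim.pow_eq_one, mul_one, sub_self, mul_zero] at e
      exact mul_ne_zero (mul_ne_zero hv₀ (sub_ne_zero.2 (hprim.ne_one hs)))
        (pow_ne_zero s hv₀) e
    · intro h0
      simp [show w = 0 from h0] at hwU
  · intro q₀ hq₀ ε hε R
    by_cases h0 : q₀ = 0
    -- For `q₀ = 0` the partition function vanishes identically in `v`.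
    · refine ⟨1, fun _ => 0, fun s hs p _ v _ _ => ⟨v, ?_, by simpa using hε⟩⟩
      rw [dichromaticZ_thetaGraph hs, h0]
      ring
    have key := fun H => TotallyBounded.exists_uniform_approx (ε := ε)
      (P := fun s p v => dichromaticZ (thetaGraph s p) q₀ v = 0)
      (S := {v | ‖v‖ ≤ ‖q₀ + v‖ ∧ ‖v‖ ≤ R})
      (totallyBounded_of_norm_le fun x hx => hx.2) H hε
    suffices H : _ by
      obtain ⟨s₀, p₀, h⟩ := key H
      exact ⟨s₀, p₀, fun s hs p hp q h1 h2 => h s hs p hp q ⟨h1, h2⟩⟩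
    intro v hv δ hδ
    have hU : IsOpen {v : ℂ | ‖v‖ < ‖q₀ + v‖} := isOpen_lt (by fun_prop) (by fun_prop)
    -- The region is a half-plane: adding `t q₀` raises `|q₀ + v|² - |v|²` by `2t|q₀|²`.
    obtain ⟨w, hwU, hw0, hwδ⟩ := exists_norm_sub_lt_and_ne hU (x := v) (d := q₀) (by
      intro t ht
      have hv1 := hv.1
      have hpos : 0 < Complex.normSq q₀ := Complex.normSq_pos.2 h0
      rw [Set.mem_ofPred_eq]
      rw [← sq_le_sq₀ (norm_nonneg _) (norm_nonneg _), ← Complex.normSq_eq_norm_sq,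
        ← Complex.normSq_eq_norm_sq] at hv1
      rw [← sq_lt_sq₀ (norm_nonneg _) (norm_nonneg _), ← Complex.normSq_eq_norm_sq,
        ← Complex.normSq_eq_norm_sq]
      simp only [Complex.normSq_apply, Complex.add_re, Complex.add_im, Complex.re_ofReal_mul,
        Complex.im_ofReal_mul] at hv1 hpos ⊢
      nlinarith [mul_pos ht hpos]) 0 hδ
    refine ⟨w, hwδ, fun ε' hε' => ?_⟩
    refine eventually_exists_dichromaticZ_thetaGraph_eq_zero (Q := fun _ => q₀)
      (V := fun v => v) (differentiable_const _) differentiable_id ?_ ?_ h0 hq₀ hw0 hwU hε'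
    · intro x c hx
      have hall := Differentiable.eq_of_eventually_eq (by fun_prop) (by fun_prop) hx
      exact h0 (by simpa using hall 0)
    · intro s hs x c hx
      have hall := Differentiable.eq_of_eventually_eq (by fun_prop) (by fun_prop) hx
      -- At `v = 0` the identity forces `c = 0`; at `v = 1` it then forces `q₀ = 0`.
      have e0 := hall 0
      have e1 := hall 1
      have hs0 : s ≠ 0 := by omega
      have hc : c = 0 := by simpa [hs0, h0] using e0
      simp [hc, h0] at e1
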